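/- Let $\mathfrak g$ be a simple finite-dimensional complex Lie algebra with Cartan subalgebra $\mathfrak h$, simple roots $\{\alpha_i\}_{i\in I}$ and Weyl group $W$ (acting on $\mathfrak h^*$) with simple reflections $s_i=s_{\alpha_i}$. Choose $e_i\in\mathfrak g_{\alpha_i}$, $f_i\in\mathfrak g_{-\alpha_i}$ with $[e_i,f_i]=\alpha_i^\vee$, let $\theta$ be the automorphism of $\mathfrak g$ with $\theta(e_i)=-f_i$, $\theta(f_i)=-e_i$ and $\theta|_{\mathfrak h}=-1$ (the complexified Cartan involution of the split real form), and let $\mathfrak k=\mathfrak g^\theta$ and $b_{\alpha_i}=f_i-e_i\in\mathfrak k$. Let $X$ be an integrable $\mathfrak k$-module; here it suffices that $X$ is a (possibly infinite) sum of finite-dimensional irreducible $\mathfrak k$-submodules, which holds for every rational representation of every connected complex reductive group $K$ with Lie algebra $\mathfrak k$. Then: 1. Each $b_{\alpha_i}$ acts diagonalizably on $X$, i.e. $X$ is the direct sum of the eigenspaces of $b_{\alpha_i}$. Hence the boundary Weyl group operator $\tilde s_i^{\mathfrak k}=\exp(\pi b_{\alpha_i}/2)$, acting on the $x$-eigenspace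 of $b_{\alpha_i}$ as the scalar $e^{\pi x/2}$, is well defined on $X$. 2. The operators $\tilde s_i^{\mathfrak k}$ on $X$ satisfy the braid relations of $W$: for all $i,j\in I$, if $m_{ij}$ is the order of $s_is_j$ in $W$, then $$\underbrace{\cdots\,\tilde s_i^{\mathfrak k}\,\tilde s_j^{\mathfrak k}}_{m_{ij}\text{ factors}}=\underbrace{\cdots\,\tilde s_j^{\mathfrak k}\,\tilde s_i^{\mathfrak k}}_{m_{ij}\text{ factors}}.$$ 3. If $w=s_{i_1}\cdots s_{i_l}=s_{j_1}\cdots s_{j_l}$ are two reduced expressions of an element $w\in W$, then $\tilde s_{i_1}^{\mathfrak k}\cdots\tilde s_{i_l}^{\mathfrak k}=\tilde s_{j_1}^{\mathfrak k}\cdots\tilde s_{j_l}^{\mathfrak k}$ on $X$. Hence $\widetilde w^{\mathfrak k}:=\tilde s_{i_1}^{\mathfrak k}\cdots\tilde s_{i_l}^{\mathfrak k}$ does not depend on the chosen reduced expression. -/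

import Mathlib

noncomputable section

open Module

/-- The value `f(b)` of a function `f : ℂ → ℂ` on a diagonalizable endomorphism `b` of a complex
vector space `X` (of any dimension): if `X` is the direct sum of the eigenspaces of `b`, then `f(b)`
acts on the eigenspace with eigenvalue `x` as multiplication by `f x`. (If `b` is not
diagonalizable, the value is the junk value `0`.) -/
def spectralFun {X : Type*} [AddCommGroup X] [Module ℂ X] (f : ℂ → ℂ) (b : End ℂ X) : End ℂ X :=
  open Classical in
  if h : DirectSum.IsInternal (fun x : ℂ => b.eigenspace x) then
    (DirectSum.toModule ℂ ℂ X (fun x : ℂ => f x • (b.eigenspace x).subtype)) ∘ₗ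
      (LinearEquiv.ofBijective
        (DirectSum.coeLinearMap (fun x : ℂ => b.eigenspace x)) h).symm.toLinearMap
  else 0

/-- `f(b)` does act as `f x` on the `x`-eigenspace of a diagonalizable `b`. -/
theorem spectralFun_apply {X : Type*} [AddCommGroup X] [Module ℂ X] (f : ℂ → ℂ) (b : End ℂ X)
    (h : DirectSum.IsInternal (fun x : ℂ => b.eigenspace x)) (x : ℂ) (v : X) (hv : b v = x • v) :
    spectralFun f b v = f x • v := by
  have hmem : v ∈ b.eigenspace x := End.mem_eigenspace_iff.mpr hv
  have hs : (LinearEquiv.ofBijective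
        (DirectSum.coeLinearMap (fun x : ℂ => b.eigenspace x)) h).symm v
      = DirectSum.lof ℂ ℂ (fun x : ℂ => b.eigenspace x) x ⟨v, hmem⟩ := by
    rw [LinearEquiv.symm_apply_eq]
    exact (DirectSum.coeLinearMap_lof (fun x : ℂ => b.eigenspace x) x ⟨v, hmem⟩).symm
  unfold spectralFun
  rw [dif_pos h]
  change (DirectSum.toModule ℂ ℂ X (fun x : ℂ => f x • (b.eigenspace x).subtype))
        ((LinearEquiv.ofBijective
          (DirectSum.coeLinearMap (fun x : ℂ => b.eigenspace x)) h).symm v) = _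
  rw [hs, DirectSum.toModule_lof]
  rfl

/-- A split symmetric pair `𝔨 ⊂ 𝔤` over `ℂ`: a simple complex Lie algebra `𝔤` with a Cartan
subalgebra `H`, a choice of simple roots `α i`, Chevalley generators `e i ∈ 𝔤_{α i}`,
`f i ∈ 𝔤_{-α i}` with `[e i, f i] = (α i)^∨`, and the Chevalley involution `θ` with
`θ (e i) = - f i`, `θ (f i) = - e i`, `θ = -1` on `H`
(the complexified Cartan involution of the split real form). -/
structure SplitSymmetricPair (𝔤 : Type*) [LieRing 𝔤] [LieAlgebra ℂ 𝔤] [FiniteDimensional ℂ 𝔤]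
    [LieAlgebra.IsSimple ℂ 𝔤] (H : LieSubalgebra ℂ 𝔤) [H.IsCartanSubalgebra] where
  /-- the simple roots -/
  base : (LieAlgebra.IsKilling.rootSystem H).Base
  e : base.support → 𝔤
  f : base.support → 𝔤
  θ : 𝔤 ≃ₗ⁅ℂ⁆ 𝔤
  e_mem : ∀ i : base.support,
    e i ∈ LieAlgebra.rootSpace H ((LieAlgebra.IsKilling.rootSystem H).root i : Dual ℂ H)
  f_mem : ∀ i : base.support,
    f i ∈ LieAlgebra.rootSpace H (-((LieAlgebra.IsKilling.rootSystem H).root i : Dual ℂ H))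
  lie_e_f : ∀ i : base.support, ⁅e i, f i⁆ = ((LieAlgebra.IsKilling.rootSystem H).coroot i : 𝔤)
  θ_e : ∀ i, θ (e i) = - f i
  θ_f : ∀ i, θ (f i) = - e i
  θ_H : ∀ h : H, θ (h : 𝔤) = - (h : 𝔤)

namespace SplitSymmetricPair

section

variable {𝔤 : Type*} [LieRing 𝔤] [LieAlgebra ℂ 𝔤] [FiniteDimensional ℂ 𝔤]
  [LieAlgebra.IsSimple ℂ 𝔤] {H : LieSubalgebra ℂ 𝔤} [H.IsCartanSubalgebra]
  (P : SplitSymmetricPair 𝔤 H)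

/-- The index set of the simple roots. -/
abbrev Node : Type _ := P.base.support

/-- `𝔨 = 𝔤^θ`, the subalgebra of fixed points of `θ`. -/
def k : LieSubalgebra ℂ 𝔤 where
  carrier := {x | P.θ x = x}
  add_mem' {x y} hx hy := (map_add P.θ x y).trans (congrArg₂ _ hx hy)
  zero_mem' := map_zero P.θ
  smul_mem' c x hx := (map_smul P.θ c x).trans (congrArg _ hx)
  lie_mem' {x y} hx hy := (LieEquiv.map_lie P.θ x y).trans (congrArg₂ _ hx hy)

/-- The element `b_{α i} = f i - e i` of `𝔨`. -/
def b (i : P.Node) : P.k :=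
  ⟨P.f i - P.e i, by
    change P.θ (P.f i - P.e i) = P.f i - P.e i
    rw [map_sub, P.θ_f, P.θ_e]; abel⟩

/-- The simple reflection `s_i` acting on `𝔥^*`. -/
def s (i : P.Node) : Dual ℂ H ≃ₗ[ℂ] Dual ℂ H :=
  (LieAlgebra.IsKilling.rootSystem H).reflection i

/-- `l = [i₁, …, i_l]` is a reduced expression `w = s_{i₁} ⋯ s_{i_l}` of `w`: no expression of `w`
as a product of simple reflections is shorter. -/
def IsReducedExpression (w : Dual ℂ H ≃ₗ[ℂ] Dual ℂ H) (l : List P.Node) : Prop :=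
  (l.map P.s).prod = w ∧ ∀ l' : List P.Node, (l'.map P.s).prod = w → l.length ≤ l'.length

variable (X : Type*) [AddCommGroup X] [Module ℂ X] [LieRingModule P.k X] [LieModule ℂ P.k X]

/-- A `𝔨`-module is called integrable here if it is a (possibly infinite) sum of finite-dimensional
irreducible submodules. For every connected complex reductive group `K` with Lie algebra `𝔨`, the
`𝔨`-module underlying any rational representation of `K` has this property, so no choice of `K` is
needed and all of them are covered. -/
def IsIntegrable : Prop :=
  sSup {N : LieSubmodule ℂ P.k X | Module.Finite ℂ N ∧ LieModule.IsIrreducible ℂ P.k N} = ⊤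

/-- The action of `b_{α i}` on a `𝔨`-module. -/
def bAct (i : P.Node) : End ℂ X := LieModule.toEnd ℂ P.k X (P.b i)

/-- The boundary Weyl group operator `exp (π b_{α i} / 2)` on a `𝔨`-module. -/
def boundaryOp (i : P.Node) : End ℂ X :=
  spectralFun (fun x => Complex.exp (Real.pi * x / 2)) (P.bAct X i)

end

end SplitSymmetricPair

end

/-! Diagonalizability: inside an `sl₂`-triple, `f - e` is conjugate to a multiple of `h`, so `ad
b_i` is diagonalizable on `𝔤` and on its invariant subspace `𝔨`. Eigenvalues add under the action,
so the eigenvectors of `b_i` in a `𝔨`-module span a submodule. It is nonzero in a finite-dimensional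
irreducible module, hence is everything there, and `X` is a sum of such modules
(`LieModule.iSup_eigenspace_eq_top_of_sSup_irreducible`).

Braid relations: since `exp` turns sums into products, the operator on `X` is compatible with the
one on the adjoint module (`boundaryOp_lie`). If a product of the operators on `𝔤` maps `e_j` to
`e_j'`, it maps `b_j` to `b_j'` because it commutes with `θ`; the same product on `X` then carries
the operator of `j` to that of `j'` (`prod_boundaryOp_mul_of_prod_adOp_e`). Taking the alternating
product with `m_{ij} - 1` factors, this is exactly the braid relation. What remains is a computation
in `𝔤`, following `e_j` through `sl₂`-strings of length at most four, for each rank-two Cartan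
matrix.

Reduced words: simple reflections satisfy the exchange condition (`exchangeCondition_s`), so
Matsumoto's theorem (`ExchangeCondition.prod_map_eq`) applies. -/

noncomputable section

open Module

/-! ### Matsumoto's theorem from the exchange condition -/

section Matsumoto

/-- The word of length `k` that alternates between `i` and `j`, starting with `i`. -/
def alternatingList {I : Type*} : I → I → ℕ → List I
  | _, _, 0 => []
  | i, j, k + 1 => i :: alternatingList j i k

variable {I G M : Type*} [Group G] [Monoid M]

@[simp]
theorem length_alternatingList (i j : I) (k : ℕ) : (alternatingList i j k).length = k := by
  induction k generalizing i j with
  | zero => rfl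
  | succ k ih => simp [alternatingList, ih]

/-- `alternatingWord` fixes the last letter and `alternatingList` the first, hence the dependence on
parity. Fixing the first letter suits an argument that grows prefixes. -/
theorem alternatingList_eq_alternatingWord (i j : I) (k : ℕ) :
    alternatingList i j k = if Even k then CoxeterSystem.alternatingWord i j k
      else CoxeterSystem.alternatingWord j i k := by
  induction k generalizing i j with
  | zero => simp [alternatingList, CoxeterSystem.alternatingWord]
  | succ k ih =>
    rw [alternatingList, ih]
    by_cases hk : Even k
    · simp [hk, Nat.even_add_one, CoxeterSystem.alternatingWord_succ']
    · simp [hk, Nat.even_add_one, CoxeterSystem.alternatingWord_succ']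

theorem prod_alternatingList_two_mul (s : I → M) (i j : I) (p : ℕ) :
    ((alternatingList i j (2 * p)).map s).prod = (s i * s j) ^ p := by
  induction p with
  | zero => simp [alternatingList]
  | succ p ih => simp [Nat.mul_add, alternatingList, ih, pow_succ', mul_assoc]

theorem prod_alternatingList_two_mul_add_one (s : I → M) (i j : I) (p : ℕ) :
    ((alternatingList i j (2 * p + 1)).map s).prod = (s i * s j) ^ p * s i := by
  rw [alternatingList, List.map_cons, List.prod_cons, prod_alternatingList_two_mul, mul_pow_mul]

/-- The palindrome of length `2 * p + 1` is prefix, letter `p`, inverse prefix; multiplying by it on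
the left reinserts the erased letter. -/
theorem prod_alternatingList_eq_mul_eraseIdx (s : I → G) (hs : ∀ i, s i * s i = 1) (i j : I)
    (p k : ℕ) (hp : p < k) :
    ((alternatingList i j k).map s).prod =
      ((alternatingList i j (2 * p + 1)).map s).prod *
        (((alternatingList i j k).eraseIdx p).map s).prod := by
  induction p generalizing i j k with
  | zero =>
    obtain ⟨k, rfl⟩ := Nat.exists_eq_add_of_lt hp
    simp [alternatingList]
  | succ p ih =>
    obtain ⟨k, rfl⟩ : ∃ k', k = k' + 1 := ⟨k - 1, by omega⟩
    have h1 := ih j i k (by omega)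
    rw [prod_alternatingList_two_mul_add_one] at h1 ⊢
    simp only [alternatingList, List.map_cons, List.prod_cons, List.eraseIdx_cons_succ, h1]
    rw [pow_succ (s i * s j), ← mul_assoc, ← mul_assoc, ← mul_assoc]
    congr 1
    rw [← mul_pow_mul]
    simp only [mul_assoc, hs, mul_one]

/-- A word is reduced if no word with the same product is shorter. -/
def IsReducedWord (s : I → G) (l : List I) : Prop :=
  ∀ l' : List I, (l'.map s).prod = (l.map s).prod → l.length ≤ l'.length

theorem IsReducedWord.of_eq {s : I → G} {l l' : List I} (h : IsReducedWord s l)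
    (hp : (l'.map s).prod = (l.map s).prod) (hl : l'.length = l.length) :
    IsReducedWord s l' := fun l'' h'' => hl ▸ h l'' (h''.trans hp)

theorem IsReducedWord.tail {s : I → G} {i : I} {l : List I} (h : IsReducedWord s (i :: l)) :
    IsReducedWord s l := fun l' h' => by
  simpa using h (i :: l') (by simp [h'])

theorem IsReducedWord.of_append {s : I → G} {k l : List I} (h : IsReducedWord s (k ++ l)) :
    IsReducedWord s l := by
  induction k with
  | nil => exact h
  | cons i k ih => exact ih h.tail

/-- The exchange condition for a family of elements of a group. -/
def ExchangeCondition (s : I → G) : Prop :=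
  ∀ (i : I) (a l : List I), IsReducedWord s (i :: a) →
    ((i :: a).map s).prod = (l.map s).prod →
    ∃ k < l.length, (a.map s).prod = ((l.eraseIdx k).map s).prod

/-- Exchange `i` into the second word. If the deleted letter lay in the alternating prefix, then `(s
i * s j) ^ (p + 1) = 1` with `0 < p + 1 ≤ k`, against the bound on `k`. So it lies in `v`, and `i`
extends the prefix. -/
theorem ExchangeCondition.exists_alternatingList_succ {s : I → G} (hex : ExchangeCondition s)
    (hs : ∀ i, s i * s i = 1) {i j : I} {a v : List I} (ha : IsReducedWord s (i :: a)) {k : ℕ}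
    (hp : ((i :: a).map s).prod = ((alternatingList j i k ++ v).map s).prod)
    (hl : (i :: a).length = (alternatingList j i k ++ v).length)
    (hk : orderOf (s i * s j) = 0 ∨ k < orderOf (s i * s j)) :
    ∃ u : List I, ((i :: a).map s).prod = ((alternatingList i j (k + 1) ++ u).map s).prod ∧
      (i :: a).length = (alternatingList i j (k + 1) ++ u).length := by
  obtain ⟨p, hpl, hpp⟩ := hex i a _ ha hp
  by_cases hpk : p < k
  · exfalso
    rw [List.eraseIdx_append_of_lt_length (by simpa using hpk)] at hpp
    simp only [List.map_cons, List.prod_cons, List.map_append, List.prod_append] at hpp hp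
    rw [hpp, ← mul_assoc, mul_left_inj, prod_alternatingList_eq_mul_eraseIdx s hs j i p k hpk,
      mul_left_inj] at hp
    have h1 : (s i * s j) ^ (p + 1) = 1 := by
      rw [← prod_alternatingList_two_mul, Nat.mul_add, mul_one, alternatingList, List.map_cons,
        List.prod_cons, ← hp, hs]
    have h2 := orderOf_dvd_of_pow_eq_one h1
    rcases hk with hk | hk
    · rw [hk, zero_dvd_iff] at h2
      omega
    · exact absurd (Nat.le_of_dvd (by omega) h2) (by omega)
  · rw [List.eraseIdx_append_of_length_le (by simpa using hpk)] at hpp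
    refine ⟨v.eraseIdx (p - k), ?_, ?_⟩
    · simp only [alternatingList, List.cons_append, List.map_cons, List.prod_cons, hpp,
        length_alternatingList]
    · simp only [List.length_append, length_alternatingList] at hl hpl ⊢
      rw [List.length_eraseIdx_of_lt (by omega)]
      omega

theorem orderOf_mul_comm_of_involutive {x y : G} (hx : x * x = 1) (hy : y * y = 1) :
    orderOf (y * x) = orderOf (x * y) := by
  rw [← orderOf_inv (x * y), mul_inv_rev, inv_eq_of_mul_eq_one_left hx,
    inv_eq_of_mul_eq_one_left hy]

theorem prod_alternatingList_orderOf {s : I → G} (hs : ∀ i, s i * s i = 1) (i j : I) :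
    ((alternatingList i j (orderOf (s i * s j))).map s).prod =
      ((alternatingList j i (orderOf (s i * s j))).map s).prod := by
  have hinv : (s j * s i)⁻¹ = s i * s j := by
    rw [mul_inv_rev, inv_eq_of_mul_eq_one_left (hs i), inv_eq_of_mul_eq_one_left (hs j)]
  have h1 := pow_orderOf_eq_one (s i * s j)
  rcases Nat.even_or_odd' (orderOf (s i * s j)) with ⟨p, hp | hp⟩
  · rw [hp] at h1 ⊢
    rw [prod_alternatingList_two_mul, prod_alternatingList_two_mul, ← mul_inv_eq_one, ← inv_pow,
      hinv, ← pow_add, ← two_mul, h1]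
  · rw [hp] at h1 ⊢
    rw [prod_alternatingList_two_mul_add_one, prod_alternatingList_two_mul_add_one,
      ← mul_inv_eq_one, mul_inv_rev, ← inv_pow, hinv, inv_eq_of_mul_eq_one_left (hs j),
      mul_assoc, ← mul_assoc (s i), ← pow_succ', ← pow_add]
    rw [← h1]
    congr 1
    omega

theorem ExchangeCondition.exists_alternatingList {s : I → G} (hex : ExchangeCondition s)
    (hs : ∀ i, s i * s i = 1) {i j : I} {a b : List I} (ha : IsReducedWord s (i :: a))
    (hp : ((i :: a).map s).prod = ((j :: b).map s).prod)
    (hl : (i :: a).length = (j :: b).length) (k : ℕ)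
    (hk : orderOf (s i * s j) = 0 ∨ k + 1 ≤ orderOf (s i * s j)) :
    ∃ u v : List I,
      (((i :: a).map s).prod = ((alternatingList i j (k + 1) ++ u).map s).prod ∧
        (i :: a).length = (alternatingList i j (k + 1) ++ u).length) ∧
      (((j :: b).map s).prod = ((alternatingList j i (k + 1) ++ v).map s).prod ∧
        (j :: b).length = (alternatingList j i (k + 1) ++ v).length) := by
  have hb : IsReducedWord s (j :: b) := ha.of_eq hp.symm hl.symm
  induction k with
  | zero => exact ⟨a, b, ⟨rfl, rfl⟩, rfl, rfl⟩
  | succ k ih =>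
    obtain ⟨u, v, ⟨hu, hu'⟩, hv, hv'⟩ := ih (by omega)
    obtain ⟨u', h1⟩ := hex.exists_alternatingList_succ hs ha (hp.trans hv) (hl.trans hv')
      (by omega)
    obtain ⟨v', h2⟩ := hex.exists_alternatingList_succ hs hb (hp.symm.trans hu)
      (hl.symm.trans hu') (by rw [orderOf_mul_comm_of_involutive (hs i) (hs j)]; omega)
    exact ⟨u', v', h1, h2⟩

/-- **Matsumoto's theorem**: if a family of involutions satisfies the exchange condition, then any
family `F` in a monoid satisfying the corresponding braid relations takes the same product along
any two reduced words of the same element. -/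
theorem ExchangeCondition.prod_map_eq {s : I → G} (hex : ExchangeCondition s)
    (hs : ∀ i, s i * s i = 1) (F : I → M)
    (hF : ∀ i j : I,
      ((CoxeterSystem.alternatingWord i j (orderOf (s i * s j))).map F).prod =
      ((CoxeterSystem.alternatingWord j i (orderOf (s i * s j))).map F).prod)
    {l l' : List I} (hl : IsReducedWord s l)
    (hp : (l.map s).prod = (l'.map s).prod) (hll : l.length = l'.length) :
    (l.map F).prod = (l'.map F).prod := by
  obtain ⟨n, hn⟩ : ∃ n, l.length ≤ n := ⟨_, le_rfl⟩
  induction n generalizing l l' with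
  | zero =>
    obtain rfl := List.length_eq_zero_iff.mp (Nat.le_zero.mp hn)
    obtain rfl := List.length_eq_zero_iff.mp hll.symm
    rfl
  | succ n ih =>
    have cons_eq : ∀ (i : I) (a c : List I), IsReducedWord s (i :: a) →
        ((i :: a).map s).prod = ((i :: c).map s).prod → (i :: a).length = (i :: c).length →
        (i :: a).length ≤ n + 1 → ((i :: a).map F).prod = ((i :: c).map F).prod := by
      intro i a c h1 h2 h3 h4
      simp only [List.map_cons, List.prod_cons, mul_right_inj] at h2 ⊢
      simp only [List.length_cons, Nat.add_right_cancel_iff, Nat.add_le_add_iff_right] at h3 h4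
      rw [ih h1.tail h2 h3 h4]
    match l, l', hn, hll with
    | [], [], _, _ => rfl
    | i :: a, j :: b, hn, hll =>
    have hb : IsReducedWord s (j :: b) := hl.of_eq hp.symm hll.symm
    -- `orderOf` is `0` for infinite order; an alternating prefix of length `n + 2` would then fit
    -- into a word of length at most `n + 1`.
    rcases Nat.eq_zero_or_pos (orderOf (s i * s j)) with h0 | h0
    · obtain ⟨u, v, ⟨-, hu⟩, -⟩ := hex.exists_alternatingList hs hl hp hll (n + 1) (Or.inl h0)
      simp only [List.length_append, length_alternatingList] at hu hn
      omega
    -- Both words are compared with words starting with a full side of the braid relation; the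
    -- remainders `u` and `v` are shorter reduced words of one element.
    · obtain ⟨k, hk⟩ : ∃ k, orderOf (s i * s j) = k + 1 := ⟨_, (Nat.sub_add_cancel h0).symm⟩
      obtain ⟨u, v, ⟨hu, hu'⟩, hv, hv'⟩ := hex.exists_alternatingList hs hl hp hll k
        (Or.inr hk.ge)
      have e1 : ((i :: a).map F).prod = ((alternatingList i j (k + 1) ++ u).map F).prod :=
        cons_eq i a _ hl hu hu' hn
      have e2 : ((j :: b).map F).prod = ((alternatingList j i (k + 1) ++ v).map F).prod :=
        cons_eq j b _ hb hv hv' (hll ▸ hn)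
      have hbF : ((alternatingList i j (k + 1)).map F).prod =
          ((alternatingList j i (k + 1)).map F).prod := by
        rw [alternatingList_eq_alternatingWord, alternatingList_eq_alternatingWord, ← hk]
        split_ifs
        exacts [hF i j, (hF i j).symm]
      have hbs := hk ▸ prod_alternatingList_orderOf hs i j
      have huv : (u.map s).prod = (v.map s).prod := by
        have := hu.symm.trans (hp.trans hv)
        simpa only [List.map_append, List.prod_append, hbs, mul_right_inj] using this
      have hru : IsReducedWord s u := (hl.of_eq hu.symm hu'.symm).of_append
      simp only [List.length_append, length_alternatingList] at hu' hv' hn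
      rw [e1, e2, List.map_append, List.map_append, List.prod_append, List.prod_append, hbF]
      rw [ih hru huv (by omega) (by omega)]

end Matsumoto

/-! ### Functional calculus for diagonalizable operators -/

section Spectral

open Polynomial hiding X

variable {X Y : Type*} [AddCommGroup X] [Module ℂ X] [AddCommGroup Y] [Module ℂ Y]

theorem isInternal_eigenspace_of_iSup_eq_top {b : End ℂ X} (h : ⨆ x, b.eigenspace x = ⊤) :
    DirectSum.IsInternal (fun x : ℂ => b.eigenspace x) :=
  DirectSum.isInternal_submodule_of_iSupIndep_of_iSup_eq_top b.eigenspaces_iSupIndep h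

theorem eigenvector_induction {b : End ℂ X} (hb : ⨆ x, b.eigenspace x = ⊤) {p : X → Prop}
    (h : ∀ (x : ℂ) (v : X), b v = x • v → p v) (hadd : ∀ v w, p v → p w → p (v + w)) (v : X) :
    p v :=
  Submodule.iSup_induction (fun x => b.eigenspace x) (motive := p) (x := v) (hb ▸ trivial)
    (fun x v hv => h x v (End.mem_eigenspace_iff.mp hv)) (h 0 0 (by simp)) hadd

theorem iSup_eigenspace_eq_top_of_surjective {b : End ℂ X} {c : End ℂ Y} {T : X →ₗ[ℂ] Y}
    (hT : Function.Surjective T) (h : ∀ v, T (b v) = c (T v)) (hb : ⨆ x, b.eigenspace x = ⊤) :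
    ⨆ x, c.eigenspace x = ⊤ := by
  rw [eq_top_iff]
  rintro w -
  obtain ⟨v, rfl⟩ := hT w
  induction v using eigenvector_induction hb with
  | h x v hv =>
    exact Submodule.mem_iSup_of_mem x (End.mem_eigenspace_iff.mpr (by rw [← h, hv, map_smul]))
  | hadd v w hv hw => rw [map_add]; exact add_mem hv hw

theorem iSup_eigenspace_smul {b : End ℂ X} (hb : ⨆ x, b.eigenspace x = ⊤) (t : ℂ) :
    ⨆ x, (t • b).eigenspace x = ⊤ := by
  rw [eq_top_iff]
  rintro w -
  induction w using eigenvector_induction hb with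
  | h x v hv =>
    exact Submodule.mem_iSup_of_mem (t * x) (End.mem_eigenspace_iff.mpr (by simp [hv, mul_smul]))
  | hadd v w hv hw => exact add_mem hv hw

theorem spectralFun_intertwine {b : End ℂ X} {c : End ℂ Y} (hb : ⨆ x, b.eigenspace x = ⊤)
    (hc : ⨆ x, c.eigenspace x = ⊤) (f : ℂ → ℂ) (T : X →ₗ[ℂ] Y) (h : ∀ v, T (b v) = c (T v))
    (v : X) : T (spectralFun f b v) = spectralFun f c (T v) := by
  induction v using eigenvector_induction hb with
  | h x v hv =>
    rw [spectralFun_apply f b (isInternal_eigenspace_of_iSup_eq_top hb) x v hv, map_smul,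
      spectralFun_apply f c (isInternal_eigenspace_of_iSup_eq_top hc) x (T v)
        (by rw [← h, hv, map_smul])]
  | hadd v w hv hw => simp only [map_add, hv, hw]

theorem aeval_apply_of_apply_eq_smul {b : End ℂ X} {x : ℂ} {v : X} (hv : b v = x • v)
    (p : ℂ[X]) : aeval b p v = p.eval x • v := by
  induction p using Polynomial.induction_on' with
  | add p q hp hq => simp [hp, hq, add_smul]
  | monomial n a =>
    have : (b ^ n) v = x ^ n • v := by
      induction n with
      | zero => simp
      | succ n ih => rw [pow_succ', End.mul_apply, ih, map_smul, hv, smul_smul, pow_succ]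
    simp [aeval_monomial, this, mul_smul, smul_comm a]

/-- On a vector killed by `q(b)`, the operator `f(b)` agrees with `p(b)` as soon as `p = f` on the
roots of `q`. -/
theorem spectralFun_eq_aeval {b : End ℂ X} (hb : ⨆ x, b.eigenspace x = ⊤) {f : ℂ → ℂ}
    (p q : ℂ[X]) (hpq : ∀ x, q.eval x = 0 → f x = p.eval x) {v : X} (hv : aeval b q v = 0) :
    spectralFun f b v = aeval b p v := by
  have hi := isInternal_eigenspace_of_iSup_eq_top hb
  -- `f = p + g * q` holds everywhere: at roots of `q` the product vanishes and `hpq` applies.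
  let g : ℂ → ℂ := fun x => (f x - p.eval x) / q.eval x
  have key : ∀ w, spectralFun f b w = aeval b p w + spectralFun g b (aeval b q w) := by
    intro w
    induction w using eigenvector_induction hb with
    | h x w hw =>
      rw [spectralFun_apply f b hi x w hw, aeval_apply_of_apply_eq_smul hw,
        aeval_apply_of_apply_eq_smul hw, map_smul, spectralFun_apply g b hi x w hw, smul_smul,
        ← add_smul]
      congr 1
      by_cases hq : q.eval x = 0
      · rw [hpq x hq, hq, zero_mul, add_zero]
      · simp only [g]
        field_simp
        ring
    | hadd v w hv hw => simp only [map_add, hv, hw]; abel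
  rw [key, hv, map_zero, add_zero]

/-- Eigenvalues add under the action, and `f` turns the sum into a product. -/
theorem spectralFun_lie {L : Type*} [LieRing L] [LieAlgebra ℂ L] [LieRingModule L X]
    [LieModule ℂ L X] (b : L) (hb : ⨆ x, (LieAlgebra.ad ℂ L b).eigenspace x = ⊤)
    (hX : ⨆ x, (LieModule.toEnd ℂ L X b).eigenspace x = ⊤) {f : ℂ → ℂ}
    (hf : ∀ x y, f (x + y) = f x * f y) (y : L) (v : X) :
    spectralFun f (LieModule.toEnd ℂ L X b) ⁅y, v⁆ =
      ⁅spectralFun f (LieAlgebra.ad ℂ L b) y, spectralFun f (LieModule.toEnd ℂ L X b) v⁆ := by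
  induction y using eigenvector_induction hb with
  | h x y hy =>
    induction v using eigenvector_induction hX with
    | h z v hv =>
      rw [spectralFun_apply f _ (isInternal_eigenspace_of_iSup_eq_top hb) x y hy,
        spectralFun_apply f _ (isInternal_eigenspace_of_iSup_eq_top hX) z v hv,
        spectralFun_apply f _ (isInternal_eigenspace_of_iSup_eq_top hX) (x + z), hf, smul_lie,
        lie_smul, smul_smul]
      rw [LieModule.toEnd_apply_apply] at hv ⊢
      rw [LieAlgebra.ad_apply] at hy
      rw [leibniz_lie, hy, hv, smul_lie, lie_smul, add_smul]
    | hadd v w hv hw => simp only [lie_add, map_add, hv, hw]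
  | hadd y z hy hz => simp only [add_lie, map_add, hy, hz]

/-- The function `x ↦ exp (π x / 2)`. -/
abbrev expHalfPi (x : ℂ) : ℂ := Complex.exp (Real.pi * x / 2)

theorem expHalfPi_add (x y : ℂ) : expHalfPi (x + y) = expHalfPi x * expHalfPi y := by
  rw [expHalfPi, expHalfPi, expHalfPi, ← Complex.exp_add]
  ring_nf

theorem expHalfPi_I : expHalfPi Complex.I = Complex.I := by
  rw [expHalfPi, show (Real.pi * Complex.I / 2 : ℂ) = (Real.pi / 2 : ℂ) * Complex.I by ring,
    Complex.exp_mul_I, Complex.cos_pi_div_two, Complex.sin_pi_div_two]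
  simp

theorem expHalfPi_neg_I : expHalfPi (-Complex.I) = -Complex.I := by
  rw [expHalfPi, show (Real.pi * -Complex.I / 2 : ℂ) = (-(Real.pi / 2) : ℂ) * Complex.I by ring,
    Complex.exp_mul_I, Complex.cos_neg, Complex.sin_neg, Complex.cos_pi_div_two,
    Complex.sin_pi_div_two]
  simp

theorem eq_or_eq_neg_mul_I {x r : ℂ} (h : x ^ 2 + r ^ 2 = 0) :
    x = r * Complex.I ∨ x = -(r * Complex.I) := by
  rw [← sq_eq_sq_iff_eq_or_eq_neg, mul_pow, Complex.I_sq]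
  linear_combination h

variable {D : End ℂ X} (hD : ⨆ x, D.eigenspace x = ⊤)
include hD

theorem spectralFun_expHalfPi_of_apply_eq_zero {v : X} (hv : D v = 0) :
    spectralFun expHalfPi D v = v := by
  rw [spectralFun_apply _ D (isInternal_eigenspace_of_iSup_eq_top hD) 0 v (by simpa using hv)]
  simp [expHalfPi]

theorem spectralFun_expHalfPi_of_sq_eq_neg {v : X} (hv : D (D v) = -v) :
    spectralFun expHalfPi D v = D v := by
  rw [spectralFun_eq_aeval hD (Polynomial.X) (Polynomial.X ^ 2 + C 1)]
  · simp
  · intro x hx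
    rcases eq_or_eq_neg_mul_I (x := x) (r := 1) (by simpa using hx) with rfl | rfl
    · simp only [one_mul, eval_X, expHalfPi_I]
    · simp only [one_mul, eval_X, expHalfPi_neg_I]
  · simp [pow_two, hv]

theorem spectralFun_expHalfPi_of_sq_eq_neg_four {v : X} (hv : D (D v) = -(4 : ℂ) • v) :
    spectralFun expHalfPi D v = -v := by
  rw [spectralFun_eq_aeval hD (C (-1)) (Polynomial.X ^ 2 + C 4)]
  · simp
  · intro x hx
    rcases eq_or_eq_neg_mul_I (x := x) (r := 2) (by norm_num; simpa using hx) with rfl | rfl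
    · rw [two_mul, expHalfPi_add, expHalfPi_I]; simp
    · rw [two_mul, neg_add, expHalfPi_add, expHalfPi_neg_I]; simp
  · simp [pow_two, hv]

theorem spectralFun_expHalfPi_of_quartic {v : X}
    (hv : D (D (D (D v))) + (10 : ℂ) • D (D v) + (9 : ℂ) • v = 0) :
    spectralFun expHalfPi D v = (7 / 6 : ℂ) • D v + (1 / 6 : ℂ) • D (D (D v)) := by
  -- The quartic is `(x² + 1)(x² + 9)`, and the odd cubic interpolates `exp (π x / 2)` at its roots:
  -- value `±I` at `±I`, and `∓I` at `±3I`.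
  rw [spectralFun_eq_aeval hD (C (7 / 6) * Polynomial.X + C (1 / 6) * Polynomial.X ^ 3) (Polynomial.X ^ 4 + C 10 * Polynomial.X ^ 2 + C 9)]
  · simp [pow_succ]
  · intro x hx
    have hx' : (x ^ 2 + 1 ^ 2) * (x ^ 2 + 3 ^ 2) = 0 := by
      simp at hx
      linear_combination hx
    have hI := Complex.I_sq
    rcases mul_eq_zero.mp hx' with h | h
    · rcases eq_or_eq_neg_mul_I h with rfl | rfl
      · simp only [one_mul, expHalfPi_I, eval_add, eval_mul, eval_C, eval_X, eval_pow]
        linear_combination (-1 / 6 * Complex.I) * hI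
      · simp only [one_mul, expHalfPi_neg_I, eval_add, eval_mul, eval_C, eval_X, eval_pow]
        linear_combination (1 / 6 * Complex.I) * hI
    · rcases eq_or_eq_neg_mul_I h with rfl | rfl
      · rw [show (3 : ℂ) * Complex.I = Complex.I + Complex.I + Complex.I by ring, expHalfPi_add,
          expHalfPi_add, expHalfPi_I]
        simp only [eval_add, eval_mul, eval_C, eval_X, eval_pow]
        linear_combination (-7 / 2 * Complex.I) * hI
      · rw [show -((3 : ℂ) * Complex.I) = -Complex.I + -Complex.I + -Complex.I by ring,
          expHalfPi_add, expHalfPi_add, expHalfPi_neg_I]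
        simp only [eval_add, eval_mul, eval_C, eval_X, eval_pow]
        linear_combination (7 / 2 * Complex.I) * hI
  · simpa [pow_succ] using hv

end Spectral

/-! ### The exchange condition in the Weyl group -/

namespace SplitSymmetricPair

section Weyl

variable {𝔤 : Type*} [LieRing 𝔤] [LieAlgebra ℂ 𝔤] [FiniteDimensional ℂ 𝔤]
  [LieAlgebra.IsSimple ℂ 𝔤] {H : LieSubalgebra ℂ 𝔤} [H.IsCartanSubalgebra]
  (P : SplitSymmetricPair 𝔤 H)

theorem s_mul_self (i : P.Node) : P.s i * P.s i = 1 := by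
  ext v : 1
  simp [s]

/-- A simple reflection permutes the positive roots other than its own. As the letters are applied
to `β`, it can leave the positive roots only at a letter whose simple root it has become; deleting
that letter is multiplication by the reflection in `β`. -/
theorem exists_reflection_mul_prod_eq_eraseIdx (l : List P.Node) (β : H.root)
    (hβ : P.base.IsPos β)
    (hl : ∀ γ, (LieAlgebra.IsKilling.rootSystem H).root γ =
      ((l.map P.s).prod)⁻¹ ((LieAlgebra.IsKilling.rootSystem H).root β) → ¬ P.base.IsPos γ) :
    ∃ k < l.length, (LieAlgebra.IsKilling.rootSystem H).reflection β * (l.map P.s).prod =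
      ((l.eraseIdx k).map P.s).prod := by
  induction l generalizing β with
  | nil => exact absurd hβ (hl β (by simp))
  | cons i l ih =>
    by_cases hi : β = i
    · refine ⟨0, by simp, ?_⟩
      subst hi
      rw [List.map_cons, List.prod_cons, ← mul_assoc]
      change P.s i * P.s i * _ = _
      rw [s_mul_self, one_mul]
      rfl
    · obtain ⟨k, hk, h⟩ := ih ((LieAlgebra.IsKilling.rootSystem H).reflectionPerm i β)
        (hβ.reflectionPerm i.2 hi) (by
          intro γ hγ
          apply hl γ
          rw [hγ, List.map_cons, List.prod_cons, mul_inv_rev, inv_eq_of_mul_eq_one_left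
            (P.s_mul_self i), RootPairing.root_reflectionPerm]
          rfl)
      refine ⟨k + 1, by simpa using hk, ?_⟩
      rw [List.eraseIdx_cons_succ, List.map_cons, List.prod_cons, List.map_cons, List.prod_cons,
        ← h, RootPairing.reflection_reflectionPerm]
      change _ = P.s i * (P.s i * _ * P.s i * _)
      simp only [← mul_assoc, s_mul_self, one_mul]

theorem exchangeCondition_s : ExchangeCondition P.s := by
  intro i a l ha hp
  obtain ⟨k, hk, h⟩ := P.exists_reflection_mul_prod_eq_eraseIdx l i
    (P.base.isPos_of_mem_support i.2) (by
      intro γ hγ hpos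
      let _ := (LieAlgebra.IsKilling.rootSystem H).indexNeg
      rw [← hp, List.map_cons, List.prod_cons, mul_inv_rev, inv_eq_of_mul_eq_one_left
            (P.s_mul_self i)] at hγ
      -- If the image of `α i` were positive, `a` alone would make `α i` negative, and a letter of
      -- `a` could be deleted to express `i :: a`, contradicting reducedness.
      obtain ⟨k, hk, h⟩ := P.exists_reflection_mul_prod_eq_eraseIdx a i
        (P.base.isPos_of_mem_support i.2) (by
          intro δ hδ hδ'
          have : δ = -γ := by
            apply (LieAlgebra.IsKilling.rootSystem H).root.injective
            rw [hδ, RootPairing.indexNeg_neg, RootPairing.root_reflectionPerm, RootPairing.reflection_apply_self, hγ, LinearEquiv.mul_apply]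
            rw [s, RootPairing.reflection_apply_self, map_neg, neg_neg]
          exact (RootPairing.Base.IsPos.neg_iff_not P.base γ).mp (this ▸ hδ') hpos)
      have := ha (a.eraseIdx k) (by rw [← h]; rfl)
      rw [List.length_eraseIdx_of_lt hk, List.length_cons] at this
      omega)
  refine ⟨k, hk, ?_⟩
  rw [← h, ← hp, List.map_cons, List.prod_cons, ← mul_assoc]
  change _ = P.s i * P.s i * _
  rw [s_mul_self, one_mul]

end Weyl

end SplitSymmetricPair

/-! ### Order of a product of two reflections -/

section ReflectionPair

variable {V : Type*} [AddCommGroup V] [Module ℂ V]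

/-- The product preserves each coset of the span of `x` and `y`, so its powers are found by
iterating an affine map on `(p, q)`. -/
theorem mul_reflection_apply {S T : V ≃ₗ[ℂ] V} {x y : V} {φ ψ : Dual ℂ V}
    (hS : ∀ v, S v = v - φ v • x) (hT : ∀ v, T v = v - ψ v • y) (hφ : φ x = 2) (hψ : ψ y = 2)
    {a b : ℂ} (ha : φ y = a) (hb : ψ x = b) (v : V) (p q : ℂ) :
    (S * T) (v + p • x + q • y) =
      v + (-p - φ v - a * (-q - ψ v - b * p)) • x + (-q - ψ v - b * p) • y := by
  rw [LinearEquiv.mul_apply, hT, hS]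
  simp only [map_sub, map_add, map_smul, smul_eq_mul, hφ, hψ, ha, hb]
  module

theorem eq_of_add_smul_add_smul_eq {x y : V} (hxy : LinearIndependent ℂ ![x, y]) {p q r s : ℂ}
    (h : (0 : V) + p • x + q • y = 0 + r • x + s • y) : p = r ∧ q = s := by
  have := LinearIndependent.pair_iff.mp hxy (p - r) (q - s) (by
    rw [zero_add, zero_add] at h
    rw [sub_smul, sub_smul, ← sub_eq_zero.mpr h]
    abel)
  exact ⟨sub_eq_zero.mp this.1, sub_eq_zero.mp this.2⟩

variable {S T : V ≃ₗ[ℂ] V} {x y : V} {φ ψ : Dual ℂ V}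
  (hS : ∀ v, S v = v - φ v • x) (hT : ∀ v, T v = v - ψ v • y) (hφ : φ x = 2) (hψ : ψ y = 2)
  (hxy : LinearIndependent ℂ ![x, y])
include hS hT hφ hψ hxy

theorem orderOf_mul_reflection_eq_two (ha : φ y = 0) (hb : ψ x = 0) : orderOf (S * T) = 2 := by
  have h1 := mul_reflection_apply hS hT hφ hψ ha hb
  refine orderOf_eq_prime ?_ ?_
  · ext v
    have := h1 v 0 0
    rw [zero_smul, zero_smul, add_zero, add_zero] at this
    rw [pow_two, LinearEquiv.mul_apply, this, h1, LinearEquiv.coe_one, id_eq]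
    module
  · intro h
    have := h1 0 0 1
    rw [h] at this
    have := (eq_of_add_smul_add_smul_eq hxy this).2
    norm_num at this

theorem orderOf_mul_reflection_eq_three (ha : φ y = -1) (hb : ψ x = -1) :
    orderOf (S * T) = 3 := by
  have h1 := mul_reflection_apply hS hT hφ hψ ha hb
  have : Fact (Nat.Prime 3) := ⟨Nat.prime_three⟩
  refine orderOf_eq_prime ?_ ?_
  · ext v
    have := h1 v 0 0
    rw [zero_smul, zero_smul, add_zero, add_zero] at this
    rw [pow_succ, pow_two, LinearEquiv.mul_apply, LinearEquiv.mul_apply, this, h1, h1,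
      LinearEquiv.coe_one, id_eq]
    module
  · intro h
    have := h1 0 0 1
    rw [h] at this
    have := (eq_of_add_smul_add_smul_eq hxy this).2
    norm_num at this

theorem orderOf_mul_reflection_eq_four (ha : φ y = -1) (hb : ψ x = -2) :
    orderOf (S * T) = 4 := by
  have h1 := mul_reflection_apply hS hT hφ hψ ha hb
  -- The square is `-1` on the plane of `x` and `y`, hence nontrivial there.
  have h2 : ∀ v (p q : ℂ), ((S * T) ^ 2) (v + p • x + q • y) =
      v + (-p - 2 * φ v - ψ v) • x + (-q - 2 * φ v - 2 * ψ v) • y := by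
    intro v p q
    rw [pow_two, LinearEquiv.mul_apply, h1, h1]
    module
  have : Fact (Nat.Prime 2) := ⟨Nat.prime_two⟩
  refine orderOf_eq_prime_pow (p := 2) (n := 1) ?_ ?_
  · intro h
    have := h2 0 0 1
    rw [pow_one] at h
    rw [h] at this
    have := (eq_of_add_smul_add_smul_eq hxy this).2
    norm_num at this
  · ext v
    have := h2 v 0 0
    rw [zero_smul, zero_smul, add_zero, add_zero] at this
    rw [show 2 ^ (1 + 1) = 2 + 2 from rfl, pow_add, LinearEquiv.mul_apply, this, h2,
      LinearEquiv.coe_one, id_eq]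
    module

theorem orderOf_mul_reflection_eq_six (ha : φ y = -1) (hb : ψ x = -3) :
    orderOf (S * T) = 6 := by
  have h1 := mul_reflection_apply hS hT hφ hψ ha hb
  have h2 : ∀ v (p q : ℂ), ((S * T) ^ 2) (v + p • x + q • y) =
      v + (p - q - 3 * φ v - 2 * ψ v) • x + (3 * p - 2 * q - 3 * φ v - 3 * ψ v) • y := by
    intro v p q
    rw [pow_two, LinearEquiv.mul_apply, h1, h1]
    module
  -- Here it is the cube that is `-1` on the plane.
  have h3 : ∀ v (p q : ℂ), ((S * T) ^ 3) (v + p • x + q • y) =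
      v + (-p - 4 * φ v - 2 * ψ v) • x + (-q - 6 * φ v - 4 * ψ v) • y := by
    intro v p q
    rw [pow_succ, LinearEquiv.mul_apply, h1, h2]
    module
  refine orderOf_eq_of_pow_and_pow_div_prime (by norm_num) ?_ ?_
  · ext v
    have := h3 v 0 0
    rw [zero_smul, zero_smul, add_zero, add_zero] at this
    rw [show 6 = 3 + 3 from rfl, pow_add, LinearEquiv.mul_apply, this, h3,
      LinearEquiv.coe_one, id_eq]
    module
  · intro p hp hp6 h
    have : p = 2 ∨ p = 3 := by
      rw [show 6 = 2 * 3 from rfl, hp.dvd_mul, Nat.prime_dvd_prime_iff_eq hp Nat.prime_two,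
        Nat.prime_dvd_prime_iff_eq hp Nat.prime_three] at hp6
      exact hp6
    rcases this with rfl | rfl
    · have := h3 0 0 1
      rw [show 6 / 2 = 3 from rfl] at h
      rw [h] at this
      have := (eq_of_add_smul_add_smul_eq hxy this).2
      norm_num at this
    · have := h2 0 0 1
      rw [show 6 / 3 = 2 from rfl] at h
      rw [h] at this
      have := (eq_of_add_smul_add_smul_eq hxy this).1
      norm_num at this

end ReflectionPair

/-! ### The operator of `f - e` on short `sl₂`-strings -/

section Strings

namespace IsSl2Triple

variable {L M : Type*} [LieRing L] [LieAlgebra ℂ L] [AddCommGroup M] [Module ℂ M]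
  [LieRingModule L M] [LieModule ℂ L M] [FiniteDimensional ℂ M] {h e f : L}
  (t : IsSl2Triple h e f) {v : M} (hfv : ⁅f, v⁆ = 0) {n : ℕ} (hhv : ⁅h, v⁆ = -(n : ℂ) • v)
  (hD : ⨆ x, (LieModule.toEnd ℂ L M (f - e)).eigenspace x = ⊤)
include t hfv

section

include hhv

/-- A lowest weight vector is primitive for the triple with `e` and `f` exchanged and `h` negated.
-/
theorem pow_succ_toEnd_e_eq_zero : (LieModule.toEnd ℂ L M e ^ (n + 1)) v = 0 := by
  by_cases hv : v = 0
  · rw [hv, map_zero]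
  · exact HasPrimitiveVectorWith.pow_toEnd_f_eq_zero_of_eq_nat (t := t.symm)
      (μ := (n : ℂ)) ⟨hv, by rw [neg_lie, hhv, neg_smul, neg_neg], hfv⟩ rfl

omit [FiniteDimensional ℂ M] in
theorem lie_f_pow_succ_toEnd_e (k : ℕ) : ⁅f, (LieModule.toEnd ℂ L M e ^ (k + 1)) v⁆ =
    (((k : ℂ) + 1) * (n - k)) • (LieModule.toEnd ℂ L M e ^ k) v := by
  by_cases hv : v = 0
  · simp [hv]
  · exact HasPrimitiveVectorWith.lie_e_pow_succ_toEnd_f (t := t.symm)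
      (μ := (n : ℂ)) ⟨hv, by rw [neg_lie, hhv, neg_smul, neg_neg], hfv⟩ k

end

include hD

theorem spectralFun_string_zero (hhv : ⁅h, v⁆ = 0) :
    spectralFun expHalfPi (LieModule.toEnd ℂ L M (f - e)) v = v := by
  apply spectralFun_expHalfPi_of_apply_eq_zero hD
  have h0 := t.pow_succ_toEnd_e_eq_zero hfv (n := 0) (by simpa using hhv)
  simp only [zero_add, pow_one, LieModule.toEnd_apply_apply] at h0
  simp [h0, hfv]

theorem spectralFun_string_one (hhv : ⁅h, v⁆ = -v) :
    spectralFun expHalfPi (LieModule.toEnd ℂ L M (f - e)) v = -⁅e, v⁆ ∧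
    spectralFun expHalfPi (LieModule.toEnd ℂ L M (f - e)) ⁅e, v⁆ = v := by
  have h2 := t.pow_succ_toEnd_e_eq_zero hfv (n := 1) (by simpa using hhv)
  have h1 := t.lie_f_pow_succ_toEnd_e hfv (n := 1) (by simpa using hhv) 0
  simp [pow_succ] at h1 h2
  constructor
  · rw [spectralFun_expHalfPi_of_sq_eq_neg hD]
    · simp [hfv]
    · simp [hfv, h1, h2]
  · rw [spectralFun_expHalfPi_of_sq_eq_neg hD]
    · simp [h1, h2]
    · simp [hfv, h1, h2]

/-- The eigenvalues on this string are `0` and `±2I`, but the middle vector has no component in the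
kernel. -/
theorem spectralFun_string_two (hhv : ⁅h, v⁆ = -(2 : ℂ) • v) :
    spectralFun expHalfPi (LieModule.toEnd ℂ L M (f - e)) ⁅e, v⁆ = -⁅e, v⁆ := by
  have h3 := t.pow_succ_toEnd_e_eq_zero hfv (n := 2) (by simpa using hhv)
  have h1 := t.lie_f_pow_succ_toEnd_e hfv (n := 2) (by simpa using hhv) 0
  have h2 := t.lie_f_pow_succ_toEnd_e hfv (n := 2) (by simpa using hhv) 1
  simp [pow_succ] at h1 h2 h3
  norm_num at h2
  apply spectralFun_expHalfPi_of_sq_eq_neg_four hD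
  simp only [LieModule.toEnd_apply_apply, sub_lie, h1, h2, h3, lie_sub, lie_smul, hfv]
  module

theorem spectralFun_string_three (hhv : ⁅h, v⁆ = -(3 : ℂ) • v) :
    spectralFun expHalfPi (LieModule.toEnd ℂ L M (f - e)) ⁅e, v⁆ = (1 / 2 : ℂ) • ⁅e, ⁅e, v⁆⁆ ∧
    spectralFun expHalfPi (LieModule.toEnd ℂ L M (f - e)) ⁅e, ⁅e, v⁆⁆ = -(2 : ℂ) • ⁅e, v⁆ := by
  have h4 := t.pow_succ_toEnd_e_eq_zero hfv (n := 3) (by simpa using hhv)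
  have h1 := t.lie_f_pow_succ_toEnd_e hfv (n := 3) (by simpa using hhv) 0
  have h2 := t.lie_f_pow_succ_toEnd_e hfv (n := 3) (by simpa using hhv) 1
  have h3 := t.lie_f_pow_succ_toEnd_e hfv (n := 3) (by simpa using hhv) 2
  simp [pow_succ] at h1 h2 h3 h4
  norm_num at h2 h3
  constructor
  · rw [spectralFun_expHalfPi_of_quartic hD]
    · simp only [LieModule.toEnd_apply_apply, sub_lie, h1, h2, h3, h4, lie_sub, lie_smul, hfv,
        lie_zero]
      module
    · simp only [LieModule.toEnd_apply_apply, sub_lie, h1, h2, h3, h4, lie_sub, lie_smul, hfv,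
        lie_zero]
      module
  · rw [spectralFun_expHalfPi_of_quartic hD]
    · simp only [LieModule.toEnd_apply_apply, sub_lie, h1, h2, h3, h4, lie_sub, lie_smul, hfv,
        lie_zero]
      module
    · simp only [LieModule.toEnd_apply_apply, sub_lie, h1, h2, h3, h4, lie_sub, lie_smul, hfv,
        lie_zero]
      module

end IsSl2Triple

end Strings

/-! ### Conjugating `h` to a multiple of `f - e` -/

section Exp

variable {L : Type*} [LieRing L] [LieAlgebra ℂ L]

theorem LieDerivation.exp_ad_apply_of_lie_lie_lie_eq_zero [LieAlgebra ℚ L] {x y : L}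
    (hx : IsNilpotent (LieDerivation.ad ℂ L x).toLinearMap) (hy : ⁅x, ⁅x, ⁅x, y⁆⁆⁆ = 0) :
    LieDerivation.exp (LieDerivation.ad ℂ L x) hx y = y + ⁅x, y⁆ + (2⁻¹ : ℚ) • ⁅x, ⁅x, y⁆⁆ := by
  rw [LieDerivation.exp_map_apply]
  have := IsNilpotent.exp_smul_eq_sum (A := End ℂ L) (a := (LieDerivation.ad ℂ L x).toLinearMap)
    (m := y) (k := 3) (by simp [pow_succ, hy]) hx
  rw [Module.End.smul_def] at this
  rw [this]
  simp [Finset.sum_range_succ, pow_succ]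

/-- The element `f - e` of an `sl₂`-triple is conjugate to a multiple of `h`. -/
theorem IsSl2Triple.exists_lieEquiv_h {h e f : L} (t : IsSl2Triple h e f)
    (he : IsNilpotent (LieAlgebra.ad ℂ L e)) (hf : IsNilpotent (LieAlgebra.ad ℂ L f)) :
    ∃ φ : L ≃ₗ⁅ℂ⁆ L, φ h = Complex.I • (f - e) := by
  let _ : Module ℚ L := Module.compHom L (algebraMap ℚ ℂ)
  have : IsScalarTower ℚ ℂ L := ⟨fun a b x => by
    rw [Algebra.smul_def, mul_smul]; rfl⟩
  let _ : LieAlgebra ℚ L := {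
    lie_smul := fun a x y => by rw [← algebraMap_smul ℂ a y, lie_smul, algebraMap_smul] }
  have hhe := t.lie_h_e_smul ℂ
  have hhf := t.lie_lie_smul_f ℂ
  have heh : ⁅e, h⁆ = -(2 : ℂ) • e := by rw [← lie_skew, hhe, neg_smul]
  have hfh : ⁅f, h⁆ = (2 : ℂ) • f := by rw [← lie_skew, hhf, neg_neg]
  have hn : ∀ (c : ℂ) {x : L}, IsNilpotent (LieAlgebra.ad ℂ L x) →
      IsNilpotent (LieDerivation.ad ℂ L (c • x)).toLinearMap := by
    intro c x hx
    have : (LieDerivation.ad ℂ L (c • x)).toLinearMap = c • LieAlgebra.ad ℂ L x := by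
      ext y; simp
    rw [this]
    exact hx.smul c
  -- The first factor sends `h` to `h + I f`. The second sends `h` to `h - 2I e` and `I f` to `I f -
  -- h + I e`, so `h` cancels.
  refine ⟨(LieDerivation.exp _ (hn (Complex.I / 2) hf)).trans
    (LieDerivation.exp _ (hn Complex.I he)), ?_⟩
  rw [LieEquiv.trans_apply]
  have h1 : LieDerivation.exp _ (hn (Complex.I / 2) hf) h = h + Complex.I • f := by
    rw [LieDerivation.exp_ad_apply_of_lie_lie_lie_eq_zero _ (by simp [hfh])]
    simp only [smul_lie, lie_smul, hfh, lie_self, smul_zero, add_zero, smul_smul]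
    rw [div_mul_cancel₀ _ (two_ne_zero' ℂ)]
  rw [h1, LieDerivation.exp_ad_apply_of_lie_lie_lie_eq_zero _ (by simp [heh, t.lie_e_f])]
  simp only [smul_lie, lie_smul, heh, lie_self, smul_zero, lie_add, t.lie_e_f]
  rw [← algebraMap_smul ℂ (2⁻¹ : ℚ)]
  have hI := Complex.I_sq
  match_scalars
  · linear_combination hI
  · simp
  · simp
    linear_combination (-Complex.I) * hI

end Exp

/-! ### Chevalley generators and diagonalizability on `𝔤` -/

namespace SplitSymmetricPair

variable {𝔤 : Type*} [LieRing 𝔤] [LieAlgebra ℂ 𝔤] [FiniteDimensional ℂ 𝔤]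
  [LieAlgebra.IsSimple ℂ 𝔤] {H : LieSubalgebra ℂ 𝔤} [H.IsCartanSubalgebra]
  (P : SplitSymmetricPair 𝔤 H)

theorem lie_coroot_e (i j : P.Node) :
    ⁅((LieAlgebra.IsKilling.rootSystem H).coroot i : 𝔤), P.e j⁆ =
      ((LieAlgebra.IsKilling.rootSystem H).pairingIn ℤ j i : ℂ) • P.e j := by
  rw [show ((LieAlgebra.IsKilling.rootSystem H).pairingIn ℤ j i : ℂ) =
    (LieAlgebra.IsKilling.rootSystem H).pairing j i from
      (LieAlgebra.IsKilling.rootSystem H).algebraMap_pairingIn ℤ j i]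
  exact LieAlgebra.IsKilling.lie_eq_smul_of_mem_rootSpace (P.e_mem j) _

theorem lie_coroot_f (i j : P.Node) :
    ⁅((LieAlgebra.IsKilling.rootSystem H).coroot i : 𝔤), P.f j⁆ =
      -((LieAlgebra.IsKilling.rootSystem H).pairingIn ℤ j i : ℂ) • P.f j := by
  rw [show ((LieAlgebra.IsKilling.rootSystem H).pairingIn ℤ j i : ℂ) =
    (LieAlgebra.IsKilling.rootSystem H).pairing j i from
      (LieAlgebra.IsKilling.rootSystem H).algebraMap_pairingIn ℤ j i]
  exact LieAlgebra.IsKilling.lie_eq_smul_of_mem_rootSpace (P.f_mem j) _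

theorem isSl2Triple (i : P.Node) :
    IsSl2Triple ((LieAlgebra.IsKilling.rootSystem H).coroot i : 𝔤) (P.e i) (P.f i) where
  h_ne_zero := by
    rw [ne_eq, ZeroMemClass.coe_eq_zero]
    exact (LieAlgebra.IsKilling.rootSystem H).flip.ne_zero i
  lie_e_f := P.lie_e_f i
  lie_h_e_nsmul := by
    rw [lie_coroot_e, RootPairing.pairingIn_same, ← Nat.cast_smul_eq_nsmul ℂ]
    norm_num
  lie_h_f_nsmul := by
    rw [lie_coroot_f, RootPairing.pairingIn_same, ← Nat.cast_smul_eq_nsmul ℂ]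
    norm_num

/-- A nonzero bracket would make the difference of two simple roots a root. -/
theorem lie_f_e_of_ne {i j : P.Node} (hij : i ≠ j) : ⁅P.f i, P.e j⁆ = 0 := by
  by_contra h0
  have hmem := LieAlgebra.lie_mem_genWeightSpace_of_mem_genWeightSpace (P.f_mem i) (P.e_mem j)
  let W : LieModule.Weight ℂ H 𝔤 := ⟨_, fun hbot => h0 (by
    rw [hbot, LieSubmodule.mem_bot] at hmem
    exact hmem)⟩
  have hW : W.toLinear = (LieAlgebra.IsKilling.rootSystem H).root j -
      (LieAlgebra.IsKilling.rootSystem H).root i := by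
    ext x
    simp [W, neg_add_eq_sub]
  have hW0 : W.IsNonZero := by
    intro hz
    rw [LieModule.Weight.IsZero] at hz
    have : W.toLinear = 0 := by ext x; simp [hz]
    rw [hW, sub_eq_zero] at this
    exact hij (Subtype.ext ((LieAlgebra.IsKilling.rootSystem H).root.injective this.symm))
  exact P.base.sub_notMem_range_root j.2 i.2 ⟨⟨W, by simpa using hW0⟩, hW⟩

theorem iSup_eigenspace_ad_eq_top (i : P.Node) :
    ⨆ x, (LieAlgebra.ad ℂ 𝔤 (P.f i - P.e i)).eigenspace x = ⊤ := by
  have hne : (LieAlgebra.IsKilling.rootSystem H).root i ≠ 0 :=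
    (LieAlgebra.IsKilling.rootSystem H).ne_zero i
  obtain ⟨φ, hφ⟩ := (P.isSl2Triple i).exists_lieEquiv_h
    (LieAlgebra.isNilpotent_ad_of_mem_rootSpace H (fun h => hne (DFunLike.coe_injective h)) (P.e_mem i))
    (LieAlgebra.isNilpotent_ad_of_mem_rootSpace H (fun h => hne (DFunLike.coe_injective (neg_eq_zero.mp h))) (P.f_mem i))
  have h1 := (LieAlgebra.IsKilling.isSemisimple_ad_of_mem_isCartanSubalgebra
    ((LieAlgebra.IsKilling.rootSystem H).coroot i).2).iSup_eigenspace_eq_top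
  refine iSup_eigenspace_eq_top_of_surjective (T := φ.toLinearEquiv.toLinearMap) φ.surjective ?_
    (iSup_eigenspace_smul h1 (-Complex.I))
  intro v
  change φ (-Complex.I • ⁅_, v⁆) = ⁅_, φ v⁆
  rw [map_smul, LieEquiv.map_lie, hφ, smul_lie, smul_smul, neg_mul, Complex.I_mul_I, neg_neg,
    one_smul]

end SplitSymmetricPair

/-! ### Diagonalizability on sums of irreducible modules -/

section Diagonalizable

variable {L M : Type*} [LieRing L] [LieAlgebra ℂ L] [AddCommGroup M] [Module ℂ M]
  [LieRingModule L M] [LieModule ℂ L M]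

variable (M) in
/-- The sum of the eigenspaces of an `ad`-diagonalizable element is a submodule. -/
def LieModule.eigenspaceSum (b : L) (hb : ⨆ x, (LieAlgebra.ad ℂ L b).eigenspace x = ⊤) :
    LieSubmodule ℂ L M where
  __ := ⨆ x, (LieModule.toEnd ℂ L M b).eigenspace x
  lie_mem {y m} hm := by
    change m ∈ ⨆ x, (LieModule.toEnd ℂ L M b).eigenspace x at hm
    change ⁅y, m⁆ ∈ ⨆ x, (LieModule.toEnd ℂ L M b).eigenspace x
    induction y using eigenvector_induction hb with
    | h x y hy =>
      induction hm using Submodule.iSup_induction' with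
      | mem z m hm =>
        refine Submodule.mem_iSup_of_mem (x + z) ?_
        rw [End.mem_eigenspace_iff, LieModule.toEnd_apply_apply] at hm ⊢
        rw [LieAlgebra.ad_apply] at hy
        rw [leibniz_lie, hy, hm, smul_lie, lie_smul, add_smul]
      | zero => simp
      | add m m' _ _ h h' => rw [lie_add]; exact add_mem h h'
    | hadd y z hy hz => rw [add_lie]; exact add_mem hy hz

theorem LieModule.mem_eigenspaceSum {b : L} {hb : ⨆ x, (LieAlgebra.ad ℂ L b).eigenspace x = ⊤}
    {m : M} : m ∈ LieModule.eigenspaceSum M b hb ↔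
      m ∈ ⨆ x, (LieModule.toEnd ℂ L M b).eigenspace x := Iff.rfl

theorem LieModule.eigenspaceSum_eq_top [FiniteDimensional ℂ M] [LieModule.IsIrreducible ℂ L M]
    (b : L) (hb : ⨆ x, (LieAlgebra.ad ℂ L b).eigenspace x = ⊤) :
    LieModule.eigenspaceSum M b hb = ⊤ := by
  have : Nontrivial M := LieModule.nontrivial_of_isIrreducible ℂ L M
  refine (eq_bot_or_eq_top _).resolve_left fun hbot => ?_
  obtain ⟨x, hx⟩ := Module.End.exists_eigenvalue (LieModule.toEnd ℂ L M b)
  obtain ⟨v, hv, hv0⟩ := hx.exists_hasEigenvector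
  apply hv0
  rw [← LieSubmodule.mem_bot (R := ℂ) (L := L), ← hbot, LieModule.mem_eigenspaceSum]
  exact Submodule.mem_iSup_of_mem x hv

theorem LieModule.iSup_eigenspace_eq_top_of_sSup_irreducible
    (h : sSup {N : LieSubmodule ℂ L M | Module.Finite ℂ N ∧ LieModule.IsIrreducible ℂ L N} = ⊤)
    (b : L) (hb : ⨆ x, (LieAlgebra.ad ℂ L b).eigenspace x = ⊤) :
    ⨆ x, (LieModule.toEnd ℂ L M b).eigenspace x = ⊤ := by
  suffices LieModule.eigenspaceSum M b hb = ⊤ by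
    rw [eq_top_iff]
    rintro m -
    rw [← LieModule.mem_eigenspaceSum (hb := hb), this]
    trivial
  rw [eq_top_iff, ← h, sSup_le_iff]
  rintro N ⟨hN, hN'⟩ m hm
  have hd : (⨆ x, (LieModule.toEnd ℂ L N b).eigenspace x) = ⊤ := by
    rw [eq_top_iff]
    rintro n -
    rw [← LieModule.mem_eigenspaceSum (hb := hb), LieModule.eigenspaceSum_eq_top]
    trivial
  rw [LieModule.mem_eigenspaceSum]
  lift m to N using hm
  induction m using eigenvector_induction hd with
  | h x v hv =>
    exact Submodule.mem_iSup_of_mem x (End.mem_eigenspace_iff.mpr (congrArg Subtype.val hv))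
  | hadd v w hv hw => exact add_mem hv hw

end Diagonalizable

/-! ### Comparing the operators on `X` and on `𝔤` -/

namespace SplitSymmetricPair

variable {𝔤 : Type*} [LieRing 𝔤] [LieAlgebra ℂ 𝔤] [FiniteDimensional ℂ 𝔤]
  [LieAlgebra.IsSimple ℂ 𝔤] {H : LieSubalgebra ℂ 𝔤} [H.IsCartanSubalgebra]
  (P : SplitSymmetricPair 𝔤 H)

theorem iSup_eigenspace_ad_b_eq_top (i : P.Node) :
    ⨆ x, (LieAlgebra.ad ℂ P.k (P.b i)).eigenspace x = ⊤ :=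
  Module.End.genEigenspace_restrict_eq_top (f := LieAlgebra.ad ℂ 𝔤 (P.f i - P.e i))
    (p := P.k.toSubmodule) (k := 1) (fun _ hx => P.k.lie_mem (P.b i).2 hx)
    (P.iSup_eigenspace_ad_eq_top i)

/-- The boundary Weyl group operator on the adjoint module `𝔤`. -/
def adOp (i : P.Node) : End ℂ 𝔤 :=
  spectralFun expHalfPi (LieAlgebra.ad ℂ 𝔤 (P.f i - P.e i))

/-- `θ` fixes `f i - e i`. Hence the image of `e j` under a product of these operators determines
those of `f j` and `b j`. -/
theorem θ_adOp (i : P.Node) (x : 𝔤) : P.θ (P.adOp i x) = P.adOp i (P.θ x) :=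
  spectralFun_intertwine (P.iSup_eigenspace_ad_eq_top i) (P.iSup_eigenspace_ad_eq_top i) _
    P.θ.toLinearEquiv.toLinearMap (fun v => by
      change P.θ ⁅P.f i - P.e i, v⁆ = ⁅P.f i - P.e i, P.θ v⁆
      rw [LieEquiv.map_lie, show P.θ (P.f i - P.e i) = _ from (P.b i).2]
      rfl) x

theorem θ_prod_adOp (l : List P.Node) (x : 𝔤) :
    P.θ ((l.map P.adOp).prod x) = (l.map P.adOp).prod (P.θ x) := by
  induction l with
  | nil => rfl
  | cons i l ih =>
    rw [List.map_cons, List.prod_cons, End.mul_apply, θ_adOp, ih, End.mul_apply]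

theorem coe_spectralFun_ad_b (i : P.Node) (x : P.k) :
    (spectralFun expHalfPi (LieAlgebra.ad ℂ P.k (P.b i)) x : 𝔤) = P.adOp i x :=
  spectralFun_intertwine (P.iSup_eigenspace_ad_b_eq_top i) (P.iSup_eigenspace_ad_eq_top i) _
    P.k.toSubmodule.subtype (fun _ => rfl) x

section Braid

variable {X : Type*} [AddCommGroup X] [Module ℂ X] [LieRingModule P.k X] [LieModule ℂ P.k X]
  (hX : P.IsIntegrable X)
include hX

theorem iSup_eigenspace_bAct_eq_top (i : P.Node) : ⨆ x, (P.bAct X i).eigenspace x = ⊤ :=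
  LieModule.iSup_eigenspace_eq_top_of_sSup_irreducible hX _ (P.iSup_eigenspace_ad_b_eq_top i)

theorem boundaryOp_lie (i : P.Node) (y : P.k) (v : X) :
    P.boundaryOp X i ⁅y, v⁆ =
      ⁅spectralFun expHalfPi (LieAlgebra.ad ℂ P.k (P.b i)) y, P.boundaryOp X i v⁆ :=
  spectralFun_lie (P.b i) (P.iSup_eigenspace_ad_b_eq_top i)
    (P.iSup_eigenspace_bAct_eq_top hX i) expHalfPi_add y v

theorem prod_boundaryOp_lie (l : List P.Node) (y z : P.k)
    (h : (l.map P.adOp).prod (y : 𝔤) = z) (v : X) :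
    (l.map (P.boundaryOp X)).prod ⁅y, v⁆ = ⁅z, (l.map (P.boundaryOp X)).prod v⁆ := by
  induction l generalizing z with
  | nil =>
    obtain rfl : y = z := Subtype.ext h
    rfl
  | cons i l ih =>
    have hmem : (l.map P.adOp).prod (y : 𝔤) ∈ P.k := by
      change P.θ _ = _
      rw [θ_prod_adOp, show P.θ (y : 𝔤) = y from y.2]
    rw [List.map_cons, List.prod_cons, End.mul_apply] at h
    rw [List.map_cons, List.prod_cons, End.mul_apply, End.mul_apply, ih ⟨_, hmem⟩ rfl,
      P.boundaryOp_lie hX]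
    congr 1
    exact Subtype.ext ((P.coe_spectralFun_ad_b i _).trans h)

/-- If a product of boundary Weyl group operators on `𝔤` maps `e j` to `e j'`, then the
corresponding product on any integrable module intertwines the operators of `j` and `j'`. -/
theorem prod_boundaryOp_mul_of_prod_adOp_e (l : List P.Node) {j j' : P.Node}
    (h : (l.map P.adOp).prod (P.e j) = P.e j') :
    (l.map (P.boundaryOp X)).prod * P.boundaryOp X j =
      P.boundaryOp X j' * (l.map (P.boundaryOp X)).prod := by
  have hf : (l.map P.adOp).prod (P.f j) = P.f j' := by
    rw [← neg_eq_iff_eq_neg.mpr (P.θ_e j), ← neg_eq_iff_eq_neg.mpr (P.θ_e j'), map_neg,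
      ← θ_prod_adOp, h]
  have hb : (l.map P.adOp).prod (P.b j : 𝔤) = P.b j' := by
    change (l.map P.adOp).prod (P.f j - P.e j) = P.f j' - P.e j'
    rw [map_sub, hf, h]
  ext v
  exact spectralFun_intertwine (P.iSup_eigenspace_bAct_eq_top hX j)
    (P.iSup_eigenspace_bAct_eq_top hX j') _ _
    (fun w => P.prod_boundaryOp_lie hX l (P.b j) (P.b j') hb w) v

end Braid

end SplitSymmetricPair

/-! ### Rank-two computations and the braid relations -/

namespace SplitSymmetricPair

variable {𝔤 : Type*} [LieRing 𝔤] [LieAlgebra ℂ 𝔤] [FiniteDimensional ℂ 𝔤]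
  [LieAlgebra.IsSimple ℂ 𝔤] {H : LieSubalgebra ℂ 𝔤} [H.IsCartanSubalgebra]
  (P : SplitSymmetricPair 𝔤 H)

section AdOp

variable {i j : P.Node} (hij : i ≠ j)
include hij

theorem adOp_e_of_pairing_eq_zero
    (h : (LieAlgebra.IsKilling.rootSystem H).pairingIn ℤ j i = 0) :
    P.adOp i (P.e j) = P.e j :=
  (P.isSl2Triple i).spectralFun_string_zero (P.lie_f_e_of_ne hij)
    (P.iSup_eigenspace_ad_eq_top i) (by rw [lie_coroot_e, h]; simp)

theorem adOp_e_of_pairing_eq_neg_one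
    (h : (LieAlgebra.IsKilling.rootSystem H).pairingIn ℤ j i = -1) :
    P.adOp i (P.e j) = ⁅P.e j, P.e i⁆ ∧ P.adOp i ⁅P.e j, P.e i⁆ = -P.e j := by
  obtain ⟨h1, h2⟩ := (P.isSl2Triple i).spectralFun_string_one (P.lie_f_e_of_ne hij)
    (P.iSup_eigenspace_ad_eq_top i) (by rw [lie_coroot_e, h]; simp)
  rw [← lie_skew (P.e j)]
  exact ⟨h1, by rw [map_neg]; exact congrArg _ h2⟩

theorem adOp_lie_e_of_pairing_eq_neg_two
    (h : (LieAlgebra.IsKilling.rootSystem H).pairingIn ℤ j i = -2) :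
    P.adOp i ⁅P.e i, P.e j⁆ = -⁅P.e i, P.e j⁆ :=
  (P.isSl2Triple i).spectralFun_string_two (P.lie_f_e_of_ne hij)
    (P.iSup_eigenspace_ad_eq_top i) (by rw [lie_coroot_e, h]; simp)

theorem adOp_lie_e_of_pairing_eq_neg_three
    (h : (LieAlgebra.IsKilling.rootSystem H).pairingIn ℤ j i = -3) :
    P.adOp i ⁅P.e i, P.e j⁆ = (1 / 2 : ℂ) • ⁅P.e i, ⁅P.e i, P.e j⁆⁆ ∧
      P.adOp i ⁅P.e i, ⁅P.e i, P.e j⁆⁆ = -(2 : ℂ) • ⁅P.e i, P.e j⁆ :=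
  (P.isSl2Triple i).spectralFun_string_three (P.lie_f_e_of_ne hij)
    (P.iSup_eigenspace_ad_eq_top i) (by rw [lie_coroot_e, h]; simp)

/-- The vector is killed by `f i` and has weight `-1 - 1 + 2 = 0` for the coroot of `i`, so it spans
a trivial string. -/
theorem adOp_lie_e_lie_e_of_pairing_eq_neg_one
    (h : (LieAlgebra.IsKilling.rootSystem H).pairingIn ℤ j i = -1) :
    P.adOp i ⁅P.e j, ⁅P.e j, P.e i⁆⁆ = ⁅P.e j, ⁅P.e j, P.e i⁆⁆ := by
  have hfj := P.lie_f_e_of_ne hij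
  have hfi : ⁅P.f i, P.e i⁆ = -((LieAlgebra.IsKilling.rootSystem H).coroot i : 𝔤) := by
    rw [← lie_skew, P.lie_e_f]
  have hj : ⁅((LieAlgebra.IsKilling.rootSystem H).coroot i : 𝔤), P.e j⁆ = -P.e j := by
    rw [lie_coroot_e, h]; simp
  have hi : ⁅((LieAlgebra.IsKilling.rootSystem H).coroot i : 𝔤), P.e i⁆ = (2 : ℂ) • P.e i :=
    (P.isSl2Triple i).lie_h_e_smul ℂ
  refine (P.isSl2Triple i).spectralFun_string_zero ?_ (P.iSup_eigenspace_ad_eq_top i) ?_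
  · rw [leibniz_lie, hfj, zero_lie, zero_add, leibniz_lie (P.f i), hfj, zero_lie, zero_add, hfi,
      lie_neg, lie_skew, hj, lie_neg, lie_self, neg_zero]
  · have hji : ⁅((LieAlgebra.IsKilling.rootSystem H).coroot i : 𝔤), ⁅P.e j, P.e i⁆⁆ =
        ⁅P.e j, P.e i⁆ := by
      rw [leibniz_lie, hj, hi, neg_lie, lie_smul, two_smul]
      abel
    rw [leibniz_lie, hj, hji, neg_lie, neg_add_cancel]

end AdOp

theorem orderOf_s_mul_s {i j : P.Node} {a b : ℤ} {m : ℕ} (hij : i ≠ j)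
    (ha : (LieAlgebra.IsKilling.rootSystem H).pairingIn ℤ j i = a)
    (hb : (LieAlgebra.IsKilling.rootSystem H).pairingIn ℤ i j = b)
    (hm : ∀ {S T : Dual ℂ H ≃ₗ[ℂ] Dual ℂ H} {x y : Dual ℂ H} {φ ψ : Dual ℂ (Dual ℂ H)},
      (∀ v, S v = v - φ v • x) → (∀ v, T v = v - ψ v • y) → φ x = 2 → ψ y = 2 →
      LinearIndependent ℂ ![x, y] → φ y = a → ψ x = b → orderOf (S * T) = m) :
    orderOf (P.s i * P.s j) = m := by
  refine hm (x := (LieAlgebra.IsKilling.rootSystem H).root i)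
    (y := (LieAlgebra.IsKilling.rootSystem H).root j)
    (φ := (LieAlgebra.IsKilling.rootSystem H).coroot' i)
    (ψ := (LieAlgebra.IsKilling.rootSystem H).coroot' j)
    (fun v => (LieAlgebra.IsKilling.rootSystem H).reflection_apply i v)
    (fun v => (LieAlgebra.IsKilling.rootSystem H).reflection_apply j v)
    ((LieAlgebra.IsKilling.rootSystem H).root_coroot_two i)
    ((LieAlgebra.IsKilling.rootSystem H).root_coroot_two j)
    (P.base.linearIndependent_pair_of_ne hij) ?_ ?_
  · rw [← ha]
    exact ((LieAlgebra.IsKilling.rootSystem H).algebraMap_pairingIn ℤ j i).symm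
  · rw [← hb]
    exact ((LieAlgebra.IsKilling.rootSystem H).algebraMap_pairingIn ℤ i j).symm

/-- Off-diagonal Cartan integers are nonpositive, which leaves four pairs up to order; symmetry of
`p` handles the order. -/
theorem pairingIn_cases {i j : P.Node} (hij : i ≠ j) {p : ℤ → ℤ → Prop}
    (hp : ∀ a b, p a b → p b a) (h0 : p 0 0) (h1 : p (-1) (-1)) (h2 : p (-1) (-2))
    (h3 : p (-1) (-3)) :
    p ((LieAlgebra.IsKilling.rootSystem H).pairingIn ℤ j i)
      ((LieAlgebra.IsKilling.rootSystem H).pairingIn ℤ i j) := by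
  have hne : (i : H.root) ≠ j := fun h => hij (Subtype.ext h)
  have h := (LieAlgebra.IsKilling.rootSystem H).pairingIn_pairingIn_mem_set_of_isCrystal_of_isRed'
    (i := j) (j := i)
    (fun h => hne ((LieAlgebra.IsKilling.rootSystem H).root.injective h.symm))
    (P.base.root_ne_neg_of_ne j.2 i.2 hne.symm)
  have hle := P.base.pairingIn_le_zero_of_ne hne.symm j.2 i.2
  simp only [Set.mem_insert_iff, Set.mem_singleton_iff, Prod.mk.injEq] at h
  rcases h with ⟨ha, hb⟩ | ⟨ha, hb⟩ | ⟨ha, hb⟩ | ⟨ha, hb⟩ | ⟨ha, hb⟩ | ⟨ha, hb⟩ | ⟨ha, hb⟩ |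
    ⟨ha, hb⟩ | ⟨ha, hb⟩ | ⟨ha, hb⟩ | ⟨ha, hb⟩
  all_goals first
    | (exfalso; omega)
    | (rw [ha, hb]; first | assumption | exact hp _ _ h2 | exact hp _ _ h3)

section Braid

variable {X : Type*} [AddCommGroup X] [Module ℂ X] [LieRingModule P.k X] [LieModule ℂ P.k X]
  (hX : P.IsIntegrable X)
include hX

theorem braid_of_pairing {i j : P.Node} (hij : i ≠ j) {b : ℤ}
    (ha : (LieAlgebra.IsKilling.rootSystem H).pairingIn ℤ j i = -1)
    (hb : (LieAlgebra.IsKilling.rootSystem H).pairingIn ℤ i j = b)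
    (hb' : b = -1 ∨ b = -2 ∨ b = -3) :
    ((CoxeterSystem.alternatingWord i j (orderOf (P.s i * P.s j))).map (P.boundaryOp X)).prod =
      ((CoxeterSystem.alternatingWord j i (orderOf (P.s i * P.s j))).map (P.boundaryOp X)).prod := by
  obtain ⟨h1, h2⟩ := P.adOp_e_of_pairing_eq_neg_one hij ha
  have h2' : P.adOp i ⁅P.e i, P.e j⁆ = P.e j := by rw [← lie_skew, map_neg, h2, neg_neg]
  rcases hb' with rfl | rfl | rfl
  · have hm : orderOf (P.s i * P.s j) = 3 := P.orderOf_s_mul_s hij ha hb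
      fun hS hT hφ hψ hxy h h' =>
        orderOf_mul_reflection_eq_three hS hT hφ hψ hxy (by simpa using h) (by simpa using h')
    obtain ⟨h3, -⟩ := P.adOp_e_of_pairing_eq_neg_one hij.symm hb
    -- `e_i ↦ [e_i, e_j] ↦ e_j`, the rightmost operator acting first.
    have h := P.prod_boundaryOp_mul_of_prod_adOp_e hX [i, j] (j := i) (j' := j) (by
      simp [h3, h2'])
    rw [hm]
    simpa [CoxeterSystem.alternatingWord, mul_assoc] using h.symm
  · have hm : orderOf (P.s i * P.s j) = 4 := P.orderOf_s_mul_s hij ha hb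
      fun hS hT hφ hψ hxy h h' =>
        orderOf_mul_reflection_eq_four hS hT hφ hψ hxy (by simpa using h) (by simpa using h')
    have h3 := P.adOp_lie_e_of_pairing_eq_neg_two hij.symm hb
    -- `e_j ↦ [e_j, e_i] ↦ -[e_j, e_i] ↦ e_j`: the two signs cancel.
    have h := P.prod_boundaryOp_mul_of_prod_adOp_e hX [i, j, i] (j := j) (j' := j) (by
      simp [h1, h3, h2'])
    rw [hm]
    simpa [CoxeterSystem.alternatingWord, mul_assoc] using h
  · have hm : orderOf (P.s i * P.s j) = 6 := P.orderOf_s_mul_s hij ha hb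
      fun hS hT hφ hψ hxy h h' =>
        orderOf_mul_reflection_eq_six hS hT hφ hψ hxy (by simpa using h) (by simpa using h')
    obtain ⟨h3, h4⟩ := P.adOp_lie_e_of_pairing_eq_neg_three hij.symm hb
    have h5 := P.adOp_lie_e_lie_e_of_pairing_eq_neg_one hij ha
    -- With `y = [e_j, e_i]` and `z = [e_j, y]`: `e_j ↦ y ↦ z / 2 ↦ z / 2 ↦ -y ↦ e_j`.
    have h := P.prod_boundaryOp_mul_of_prod_adOp_e hX [i, j, i, j, i] (j := j) (j' := j) (by
      simp [h1, h2', h3, h4, h5])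
    rw [hm]
    simpa [CoxeterSystem.alternatingWord, mul_assoc] using h

theorem braid_boundaryOp (i j : P.Node) :
    ((CoxeterSystem.alternatingWord i j (orderOf (P.s i * P.s j))).map (P.boundaryOp X)).prod =
      ((CoxeterSystem.alternatingWord j i (orderOf (P.s i * P.s j))).map (P.boundaryOp X)).prod := by
  by_cases hij : i = j
  · rw [hij]
  have key := P.pairingIn_cases hij (p := fun a b => (a = 0 ∧ b = 0) ∨
    (a = -1 ∧ (b = -1 ∨ b = -2 ∨ b = -3)) ∨ (b = -1 ∧ (a = -1 ∨ a = -2 ∨ a = -3)))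
    (by intros; tauto) (by simp) (by simp) (by simp) (by simp)
  rcases key with ⟨ha, hb⟩ | ⟨ha, hb⟩ | ⟨hb, ha⟩
  · have hm : orderOf (P.s i * P.s j) = 2 := P.orderOf_s_mul_s hij ha hb
      fun hS hT hφ hψ hxy h h' =>
        orderOf_mul_reflection_eq_two hS hT hφ hψ hxy (by simpa using h) (by simpa using h')
    have h := P.prod_boundaryOp_mul_of_prod_adOp_e hX [i] (j := j) (j' := j) (by
      simp [P.adOp_e_of_pairing_eq_zero hij ha])
    rw [hm]
    simpa [CoxeterSystem.alternatingWord] using h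
  · exact P.braid_of_pairing hX hij ha rfl hb
  · rw [← orderOf_mul_comm_of_involutive (P.s_mul_self i) (P.s_mul_self j)]
    exact (P.braid_of_pairing hX (Ne.symm hij) hb rfl ha).symm

end Braid

end SplitSymmetricPair

end

theorem mainTheorem10 {𝔤 : Type*} [LieRing 𝔤] [LieAlgebra ℂ 𝔤] [FiniteDimensional ℂ 𝔤]
    [LieAlgebra.IsSimple ℂ 𝔤] (H : LieSubalgebra ℂ 𝔤) [H.IsCartanSubalgebra]
    (P : SplitSymmetricPair 𝔤 H)
    (X : Type*) [AddCommGroup X] [Module ℂ X] [LieRingModule P.k X] [LieModule ℂ P.k X]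
    (hX : P.IsIntegrable X) :
    -- `X` is the direct sum of the eigenspaces of each `b_{α i}`, so `exp (π b_{α i} / 2)` makes sense
    (∀ i : P.Node, DirectSum.IsInternal (fun x : ℂ => (P.bAct X i).eigenspace x)) ∧
    -- braid relations: the alternating products of length `m_{ij}`, the order of `s_i s_j`, agree
    (∀ i j : P.Node,
      ((CoxeterSystem.alternatingWord i j (orderOf (P.s i * P.s j))).map (P.boundaryOp X)).prod =
      ((CoxeterSystem.alternatingWord j i (orderOf (P.s i * P.s j))).map (P.boundaryOp X)).prod) ∧
    -- independence of the reduced expression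
    (∀ (w : Module.Dual ℂ H ≃ₗ[ℂ] Module.Dual ℂ H) (l l' : List P.Node),
      P.IsReducedExpression w l → P.IsReducedExpression w l' →
      (l.map (P.boundaryOp X)).prod = (l'.map (P.boundaryOp X)).prod) := by
  refine ⟨fun i => isInternal_eigenspace_of_iSup_eq_top (P.iSup_eigenspace_bAct_eq_top hX i),
    P.braid_boundaryOp hX, fun w l l' hl hl' => ?_⟩
  refine P.exchangeCondition_s.prod_map_eq P.s_mul_self (P.boundaryOp X) (P.braid_boundaryOp hX)
    (fun l'' h => ?_) (hl.1.trans hl'.1.symm) (le_antisymm (hl.2 _ hl'.1) (hl'.2 _ hl.1))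
  exact hl.2 l'' (h.trans hl.1)
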